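/- **Model.** A typical user (UE) is at the origin. Horizontal locations of LoS aerial base stations (ABSs), NLoS ABSs and terrestrial base stations (TBSs) are independent Poisson point processes $\Phi_L,\Phi_N,\Phi_T$ in $\mathbb R^2$ with intensities $\lambda_A P_L(|x|)$, $\lambda_A(1-P_L(|x|))$ and $\lambda_T$, where $P_L(x)=\bigl(1+a\exp(-b\frac{180}{\pi}\arctan(\frac hx-a))\bigr)^{-1}$, $a,b,\lambda_A,\lambda_T>0$. All ABSs have altitude $h>0$; $R_{L,i},R_{N,i}$ are the distances from the UE to the ABSs, $R_{T,i}$ those to the TBSs, index $0$ denoting the nearest one of each kind. The channel gains $H_{L,i}\sim\Gamma(m_L,1/m_L)$, $H_{N,i}\sim\Gamma(m_N,1/m_N)$ (shape, scale; $m_L,m_N\ge 1$ integers) are independent of each other and of all locations. Let $P_A,P_T,C_L,C_N,C_T,G_M,R_B,\alpha_T,\sigma_A^2>0$, $\alpha_L,\alpha_N>2$, $R_f\ge h$, $0\le\beta<1$, and $a_m>a_n>0$, $a_m+a_n=1$. The UE is associated with the nearest LoS ABS on the event $$B_L=\bigl\{a_nP_AC_LR_{L,0}^{-\alpha_L}>\max\bigl(a_nP_AC_NR_{N,0}^{-\alpha_N},\;G_MP_TC_TR_{T,0}^{-\alpha_T}\mathbf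 1\{R_{T,0}\le R_B\}\bigr)\bigr\}.$$ The interference is $I_A=\sum_{i\ge1}P_AC_LR_{L,i}^{-\alpha_L}H_{L,i}+\sum_{i\ge0}P_AC_NR_{N,i}^{-\alpha_N}H_{N,i}$. With $S=P_AC_LR_{L,0}^{-\alpha_L}H_{L,0}$ put $$\gamma_{t\to f}=\frac{a_mS}{a_nS+I_A+\sigma_A^2},\qquad \gamma_t=\frac{a_nS}{I_A+\sigma_A^2+\beta a_mS}.$$ For thresholds $\epsilon_f,\epsilon_t>0$ let $P_{cov}(r)=\mathbb P(\gamma_{t\to f}>\epsilon_f,\ \gamma_t>\epsilon_t\mid B_L,\ R_{L,0}=r)$. Let $\mathbb E_r$ be the conditional expectation given $B_L$ and $R_{L,0}=r$, and $L_{I_A}(s)=\mathbb E_r[e^{-sI_A}]$. **Proposition.** For almost every $r\le R_f$, with respect to the conditional law of $R_{L,0}$ given $B_L$, the following hold. 1. If $a_m-a_n\epsilon_f>0$ and $a_n-\beta a_m\epsilon_t>0$, let $\epsilon^*=\max\{\frac{\epsilon_f}{a_m-a_n\epsilon_f},\frac{\epsilon_t}{a_n-\beta a_m\epsilon_t}\}$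 and $s_e=\frac{e\,r^{\alpha_L}}{P_AC_L}$. Then $P_{cov}(r)=E(\epsilon^*)$, where $$E(e)=\sum_{k=0}^{m_L-1}\sum_{p=0}^{k}\binom kp\frac{r^{\alpha_Lk}(m_Le)^k}{k!(P_AC_L)^k}e^{-m_Ls_e\sigma_A^2}(\sigma_A^2)^p\,\mathbb E_r\bigl[e^{-m_Ls_eI_A}I_A^{k-p}\bigr].$$ Put $A_b(e)=\sum_{k=1}^{m_L}(-1)^{k+1}\binom{m_L}ke^{-kbs_e\sigma_A^2}L_{I_A}(kbs_e)$ and $b_L=m_L(m_L!)^{-1/m_L}$. The approximation $P_{cov}(r)\approx A_{b_L}(\epsilon^*)$ holds in the following sense: $A_{b_L}(\epsilon^*)$ is what the coverage probability becomes when $\mathbb P(H_{L,0}<t)$ is replaced by $(1-e^{-b_Lt})^{m_L}$, that is, $A_{b_L}(\epsilon^*)=\mathbb E_r\bigl[1-(1-e^{-b_Ls_{\epsilon^*}(I_A+\sigma_A^2)})^{m_L}\bigr]$, and $$A_{m_L}(\epsilon^*)\le P_{cov}(r)\le A_{b_L}(\epsilon^*).$$ (For $m_L=1$ both bounds coincide.)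 2. If $a_m-a_n\epsilon_f\ge0$ and $a_n-\beta a_m\epsilon_t\ge0$ and at least one is an equality (so $\epsilon^*=+\infty$), then $P_{cov}(r)=0$, and $E(e)\to0$ and $A_{b_L}(e)\to0$ as $e\to\infty$; thus the expressions of part 1 remain valid as limits. 3. If $a_m-a_n\epsilon_f<0$ or $a_n-\beta a_m\epsilon_t<0$, then $P_{cov}(r)=0$. -/

import Mathlib

open MeasureTheory ProbabilityTheory Filter Topology
open scoped ENNReal NNReal

noncomputable section

/-- Parameters of the two-tier network: terrestrial base stations (TBSs) and aerial base
stations (ABSs). -/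
structure NetworkParams where
  /-- density of TBSs -/
  lamT : ℝ
  /-- density of ABSs -/
  lamA : ℝ
  /-- altitude of the ABSs -/
  h : ℝ
  /-- radius of the mmWave line-of-sight ball -/
  RB : ℝ
  /-- distance between the fixed UE and its serving ABS -/
  Rf : ℝ
  /-- S-curve parameters of the line-of-sight probability -/
  sa : ℝ
  sb : ℝ
  /-- path loss exponents -/
  alphaL : ℝ
  alphaN : ℝ
  alphaT : ℝ
  /-- additive losses -/
  CL : ℝ
  CN : ℝ
  CT : ℝ
  /-- Nakagami fading parameters of the LoS and NLoS links -/
  mL : ℕ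
  mN : ℕ
  /-- transmit powers -/
  PT : ℝ
  PA : ℝ
  /-- main-lobe gain of the TBSs -/
  GM : ℝ
  /-- NOMA power allocation factors of the far (`am`) and of the near (`an`) UE -/
  am : ℝ
  an : ℝ
  /-- imperfect SIC coefficient -/
  beta : ℝ
  /-- noise power in the ABS tier (the quantity `σ_A²`) -/
  noise : ℝ

namespace NetworkParams

/-- The standing assumptions on the parameters. The exponents of the aerial links exceed `2`, so
that the aggregate interference is almost surely finite. -/
structure Admissible (p : NetworkParams) : Prop where
  lamT_pos : 0 < p.lamT
  lamA_pos : 0 < p.lamA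
  h_pos : 0 < p.h
  RB_pos : 0 < p.RB
  h_le_Rf : p.h ≤ p.Rf
  sa_pos : 0 < p.sa
  sb_pos : 0 < p.sb
  two_lt_alphaL : 2 < p.alphaL
  two_lt_alphaN : 2 < p.alphaN
  alphaT_pos : 0 < p.alphaT
  CL_pos : 0 < p.CL
  CN_pos : 0 < p.CN
  CT_pos : 0 < p.CT
  mL_pos : 0 < p.mL
  mN_pos : 0 < p.mN
  PT_pos : 0 < p.PT
  PA_pos : 0 < p.PA
  GM_pos : 0 < p.GM
  an_pos : 0 < p.an
  an_lt_am : p.an < p.am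
  am_add_an : p.am + p.an = 1
  beta_nonneg : 0 ≤ p.beta
  beta_lt_one : p.beta < 1
  noise_pos : 0 < p.noise

/-- Probability that the link to an ABS at horizontal distance `x` is line-of-sight. -/
def probLoS (p : NetworkParams) (x : ℝ) : ℝ :=
  1 / (1 + p.sa * Real.exp (-p.sb * (180 / Real.pi) * Real.arctan (p.h / x - p.sa)))

/-- Probability that the link to an ABS at horizontal distance `x` is non-line-of-sight. -/
def probNLoS (p : NetworkParams) (x : ℝ) : ℝ := 1 - p.probLoS x

/-- Intensity measure on the plane of the LoS ABSs. -/
def intensityL (p : NetworkParams) : Measure (EuclideanSpace ℝ (Fin 2)) :=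
  volume.withDensity fun x => ENNReal.ofReal (p.lamA * p.probLoS ‖x‖)

/-- Intensity measure on the plane of the NLoS ABSs. -/
def intensityN (p : NetworkParams) : Measure (EuclideanSpace ℝ (Fin 2)) :=
  volume.withDensity fun x => ENNReal.ofReal (p.lamA * p.probNLoS ‖x‖)

/-- Intensity measure on the plane of the TBSs. -/
def intensityT (p : NetworkParams) : Measure (EuclideanSpace ℝ (Fin 2)) :=
  volume.withDensity fun _ => ENNReal.ofReal p.lamT

/-- Coefficients of the average received powers. -/
def etaL (p : NetworkParams) : ℝ := p.an * p.PA * p.CL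
def etaN (p : NetworkParams) : ℝ := p.an * p.PA * p.CN
def etaT (p : NetworkParams) : ℝ := p.GM * p.PT * p.CT

/-- SINR of the near typical UE when it decodes the message of the fixed UE: the serving LoS ABS
is at distance `r`, the channel gain is `g`, the aggregate interference is `I`. -/
def sinrFixed (p : NetworkParams) (r g I : ℝ) : ℝ :=
  (p.am * p.PA * p.CL * r ^ (-p.alphaL) * g) /
    (p.an * p.PA * p.CL * r ^ (-p.alphaL) * g + I + p.noise)

/-- SINR of the near typical UE when it decodes its own message after imperfect SIC. -/
def sinrOwn (p : NetworkParams) (r g I : ℝ) : ℝ :=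
  (p.an * p.PA * p.CL * r ^ (-p.alphaL) * g) /
    (I + p.noise + p.beta * p.am * p.PA * p.CL * r ^ (-p.alphaL) * g)

end NetworkParams

/-- The number of points of the sequence `X` in the set `B`. -/
def pointCount {Ω E : Type*} (X : ℕ → Ω → E) (B : Set E) (ω : Ω) : ℕ∞ :=
  Set.encard {i : ℕ | X i ω ∈ B}

/-- The random points `X 0, X 1, …` form a Poisson point process with intensity measure `Λ` on
the plane, enumerated in such a way that `X 0` is a point nearest to the origin. -/
structure IsPoissonProcess {Ω : Type*} [MeasurableSpace Ω] (μ : Measure Ω)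
    (X : ℕ → Ω → EuclideanSpace ℝ (Fin 2)) (Λ : Measure (EuclideanSpace ℝ (Fin 2))) : Prop where
  measurable : ∀ i, Measurable (X i)
  count_law : ∀ B, MeasurableSet B → Λ B < ∞ →
    μ.map (pointCount X B) = (poissonMeasure (Λ B).toNNReal).map (fun n : ℕ => (n : ℕ∞))
  count_indep : ∀ (n : ℕ) (B : Fin n → Set (EuclideanSpace ℝ (Fin 2))),
    (∀ j, MeasurableSet (B j)) → Pairwise (fun i j => Disjoint (B i) (B j)) →
      iIndepFun (fun j => pointCount X (B j)) μ
  nearest : ∀ᵐ ω ∂μ, ∀ i, ‖X 0 ω‖ ≤ ‖X i ω‖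

/-- The random network seen from the typical UE at the origin: horizontal locations of the LoS
ABSs, NLoS ABSs and TBSs, and the power gains of the aerial links. `Γ(m, 1/m)` in shape/scale form
is `gammaMeasure m m` in shape/rate form. The five families are mutually independent. -/
structure HetNet (p : NetworkParams) {Ω : Type*} [MeasurableSpace Ω] (μ : Measure Ω) where
  XL : ℕ → Ω → EuclideanSpace ℝ (Fin 2)
  XN : ℕ → Ω → EuclideanSpace ℝ (Fin 2)
  XT : ℕ → Ω → EuclideanSpace ℝ (Fin 2)
  HL : ℕ → Ω → ℝ
  HN : ℕ → Ω → ℝ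
  poisson_L : IsPoissonProcess μ XL p.intensityL
  poisson_N : IsPoissonProcess μ XN p.intensityN
  poisson_T : IsPoissonProcess μ XT p.intensityT
  measurable_HL : ∀ i, Measurable (HL i)
  measurable_HN : ∀ i, Measurable (HN i)
  law_HL : ∀ i, μ.map (HL i) = gammaMeasure p.mL p.mL
  law_HN : ∀ i, μ.map (HN i) = gammaMeasure p.mN p.mN
  indep_HL : iIndepFun HL μ
  indep_HN : iIndepFun HN μ
  indep_XL : IndepFun (fun ω i => XL i ω)
    (fun ω => ((fun i => XN i ω), (fun i => XT i ω), (fun i => HL i ω), (fun i => HN i ω))) μ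
  indep_XN : IndepFun (fun ω i => XN i ω)
    (fun ω => ((fun i => XT i ω), (fun i => HL i ω), (fun i => HN i ω))) μ
  indep_XT : IndepFun (fun ω i => XT i ω) (fun ω => ((fun i => HL i ω), (fun i => HN i ω))) μ
  indep_HL_HN : IndepFun (fun ω i => HL i ω) (fun ω i => HN i ω) μ

namespace HetNet

variable {p : NetworkParams} {Ω : Type*} [MeasurableSpace Ω] {μ : Measure Ω}

/-- Distance from the typical UE to the `i`-th LoS ABS; `distL 0` is the distance `R_{L,0}`. -/
def distL (N : HetNet p μ) (i : ℕ) (ω : Ω) : ℝ := Real.sqrt (‖N.XL i ω‖ ^ 2 + p.h ^ 2)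

/-- Distance from the typical UE to the `i`-th NLoS ABS. -/
def distN (N : HetNet p μ) (i : ℕ) (ω : Ω) : ℝ := Real.sqrt (‖N.XN i ω‖ ^ 2 + p.h ^ 2)

/-- Distance from the typical UE to the `i`-th TBS. -/
def distT (N : HetNet p μ) (i : ℕ) (ω : Ω) : ℝ := ‖N.XT i ω‖

/-- Average powers received from the nearest base station of each kind. -/
def powerL (N : HetNet p μ) (ω : Ω) : ℝ := p.etaL * N.distL 0 ω ^ (-p.alphaL)
def powerN (N : HetNet p μ) (ω : Ω) : ℝ := p.etaN * N.distN 0 ω ^ (-p.alphaN)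
def powerT (N : HetNet p μ) (ω : Ω) : ℝ :=
  p.etaT * N.distT 0 ω ^ (-p.alphaT) * (if N.distT 0 ω ≤ p.RB then 1 else 0)

/-- The event that the typical UE is associated with a LoS ABS. -/
def assocLoS (N : HetNet p μ) : Set Ω := {ω | N.powerN ω < N.powerL ω ∧ N.powerT ω < N.powerL ω}

/-- Interference from the non-serving LoS ABSs. -/
def interfL (N : HetNet p μ) (ω : Ω) : ℝ :=
  ∑' i : ℕ, p.PA * p.CL * N.distL (i + 1) ω ^ (-p.alphaL) * N.HL (i + 1) ω

/-- Interference from the NLoS ABSs. -/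
def interfN (N : HetNet p μ) (ω : Ω) : ℝ :=
  ∑' i : ℕ, p.PA * p.CN * N.distN i ω ^ (-p.alphaN) * N.HN i ω

/-- Aggregate interference from the ABSs. -/
def interfA (N : HetNet p μ) (ω : Ω) : ℝ := N.interfL ω + N.interfN ω

/-- The law of the network given association with a LoS ABS. -/
def lawLoS (N : HetNet p μ) : Measure Ω := ProbabilityTheory.cond μ N.assocLoS

instance [IsProbabilityMeasure μ] (N : HetNet p μ) : IsFiniteMeasure N.lawLoS := by
  unfold lawLoS; infer_instance

variable [IsProbabilityMeasure μ]

/-- Conditional law of the serving channel gain and the interference `(H_{L,0}, I_A)`, given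
association with a LoS ABS and `R_{L,0} = r`. -/
def condLawGainInterf (N : HetNet p μ) : Kernel ℝ (ℝ × ℝ) :=
  condDistrib (fun ω => (N.HL 0 ω, N.interfA ω)) (N.distL 0) N.lawLoS

/-- Conditional law of the interference `I_A`, given association with a LoS ABS and
`R_{L,0} = r`. -/
def condLawInterf (N : HetNet p μ) : Kernel ℝ ℝ :=
  condDistrib N.interfA (N.distL 0) N.lawLoS

/-- Coverage probability of the near typical UE in the LoS state, given `R_{L,0} = r`. -/
def coverageNearLoS (N : HetNet p μ) (epsF epsT r : ℝ) : ℝ :=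
  (N.condLawGainInterf r).real
    {q | epsF < p.sinrFixed r q.1 q.2 ∧ epsT < p.sinrOwn r q.1 q.2}

/-- `E[exp(-s I_A) I_A ^ j]`, given association with a LoS ABS and `R_{L,0} = r`. -/
def expMoment (N : HetNet p μ) (r s : ℝ) (j : ℕ) : ℝ :=
  ∫ y, Real.exp (-s * y) * y ^ j ∂(N.condLawInterf r)

/-- Laplace transform of `I_A` at `s`, given association with a LoS ABS and `R_{L,0} = r`. -/
def laplaceInterf (N : HetNet p μ) (r s : ℝ) : ℝ :=
  ∫ y, Real.exp (-s * y) ∂(N.condLawInterf r)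

/-- The finite double sum, as a function of the distance `r` and the effective threshold `e`. -/
def exactSum (N : HetNet p μ) (r e : ℝ) : ℝ :=
  ∑ k ∈ Finset.range p.mL, ∑ q ∈ Finset.range (k + 1),
    (k.choose q : ℝ) * (r ^ (p.alphaL * k) * (p.mL * e) ^ k / (k.factorial * (p.PA * p.CL) ^ k)) *
      Real.exp (-p.mL * (e * r ^ p.alphaL / (p.PA * p.CL)) * p.noise) * p.noise ^ q *
      N.expMoment r (p.mL * (e * r ^ p.alphaL / (p.PA * p.CL))) (k - q)

/-- The alternating binomial sum of values of the Laplace transform, as a function of the rate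
`b`, the distance `r` and the effective threshold `e`. -/
def alternatingSum (N : HetNet p μ) (b r e : ℝ) : ℝ :=
  ∑ k ∈ Finset.Icc 1 p.mL, (-1) ^ (k + 1) * (p.mL.choose k : ℝ) *
    Real.exp (-(k * b * (e * r ^ p.alphaL * p.noise / (p.PA * p.CL)))) *
      N.laplaceInterf r (k * b * (e * r ^ p.alphaL / (p.PA * p.CL)))

end HetNet

namespace NetworkParams

/-- The effective threshold `ε*`. -/
def epsStar (p : NetworkParams) (epsF epsT : ℝ) : ℝ :=
  max (epsF / (p.am - p.an * epsF)) (epsT / (p.an - p.beta * p.am * epsT))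

/-- The rate `b_L = m_L (m_L!)^(-1/m_L)`. -/
def bL (p : NetworkParams) : ℝ := p.mL * (p.mL.factorial : ℝ) ^ (-(1 / (p.mL : ℝ)))

end NetworkParams

end

/-! The association event, the serving distance and (almost surely) the interference are functions
of everything in the network except the serving gain `H`, and `H` is independent of all that.
Conditioning on association and on the serving distance `r` therefore leaves `H` gamma distributed
and independent of the interference (`condLawGainInterf_ae_eq`).

For a fixed interference value `y`, clearing denominators makes both SINR conditions linear in the
gain `g`. If both coefficients are positive, they merge into `g > s (y + noise)` with `s = ε* r^α /
(PA CL)` (`covered_iff`); if one coefficient is nonpositive, coverage is impossible. With `Q` the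
Erlang tail of shape `m`, the coverage probability is thus the mean of `Q(m s (I + noise))`.

The binomial theorem turns this mean into the double sum, and turns the mean of `1 - (1 - exp(-b s
(I + noise)))^m` into the alternating sum. The bounds are the pointwise sandwich `1 - (1 - e^{-u})^m
≤ Q(u) ≤ 1 - (1 - e^{-cu})^m` for `u ≥ 0`, with `c = (m!)^{-1/m}`: the lower half is an induction,
the upper half is Alzer's inequality. The boundary limits hold because the positive noise drives the
arguments of these tails to infinity. -/

/-! ### Erlang tails and their exponential bounds -/

/-- The tail `P(H > u)` of the Erlang distribution of integer shape `m` and rate `1`. -/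
noncomputable def erlangTail (m : ℕ) (u : ℝ) : ℝ :=
  ∑ k ∈ Finset.range m, u ^ k / k.factorial * Real.exp (-u)

theorem erlangTail_nonneg (m : ℕ) {u : ℝ} (hu : 0 ≤ u) : 0 ≤ erlangTail m u :=
  Finset.sum_nonneg fun _ _ => by positivity

theorem erlangTail_succ_zero (m : ℕ) : erlangTail (m + 1) 0 = 1 := by
  simp [erlangTail, Finset.sum_range_succ']

theorem continuous_erlangTail (m : ℕ) : Continuous (erlangTail m) := by
  unfold erlangTail; fun_prop

/-- Differentiating the partial exponential sum telescopes, leaving only minus the Erlang density.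
-/
theorem hasDerivAt_erlangTail_succ (m : ℕ) (u : ℝ) :
    HasDerivAt (erlangTail (m + 1)) (-(u ^ m / m.factorial * Real.exp (-u))) u := by
  have hexp : HasDerivAt (fun u : ℝ => Real.exp (-u)) (-Real.exp (-u)) u := by
    simpa using (hasDerivAt_neg u).exp
  induction m with
  | zero =>
    have : erlangTail (0 + 1) = fun u : ℝ => Real.exp (-u) := by
      funext u; simp [erlangTail]
    rw [this]; simpa using hexp
  | succ m ih =>
    have : erlangTail (m + 1 + 1) = fun u : ℝ =>
        erlangTail (m + 1) u + u ^ (m + 1) / (m + 1).factorial * Real.exp (-u) := by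
      funext u; simp [erlangTail, Finset.sum_range_succ]
    rw [this]
    have h2 := ih.add ((((hasDerivAt_pow (m + 1) u)).div_const ((m + 1).factorial : ℝ)).mul hexp)
    refine h2.congr_deriv ?_
    have : (m.factorial : ℝ) ≠ 0 := by positivity
    rw [Nat.factorial_succ]
    push_cast
    field_simp
    simp

theorem tendsto_erlangTail_atTop (m : ℕ) : Tendsto (erlangTail m) atTop (𝓝 0) := by
  have : Tendsto (fun u => ∑ k ∈ Finset.range m, u ^ k * Real.exp (-u) / k.factorial) atTop
      (𝓝 (∑ k ∈ Finset.range m, (0 : ℝ) / k.factorial)) :=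
    tendsto_finsetSum _ fun k _ =>
      (Real.tendsto_pow_mul_exp_neg_atTop_nhds_zero k).div_const _
  simp only [zero_div, Finset.sum_const_zero] at this
  refine this.congr fun u => Finset.sum_congr rfl fun k _ => by ring

theorem antitoneOn_erlangTail (m : ℕ) : AntitoneOn (erlangTail m) (Set.Ici 0) := by
  cases m with
  | zero => intro a _ b _ _; simp [erlangTail]
  | succ m =>
    refine antitoneOn_of_deriv_nonpos (convex_Ici 0) (continuous_erlangTail _).continuousOn
      (fun u _ => (hasDerivAt_erlangTail_succ m u).differentiableAt.differentiableWithinAt) ?_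
    intro u hu
    rw [interior_Ici, Set.mem_Ioi] at hu
    rw [(hasDerivAt_erlangTail_succ m u).deriv]
    have : 0 ≤ u ^ m / m.factorial * Real.exp (-u) := by positivity
    linarith

/-- Dropping the factor `exp (-u) ≤ 1` from the Erlang density and integrating from `0` gives the
bound. It supplies the induction step of `one_sub_erlangTail_le`. -/
theorem one_sub_erlangTail_le_pow_div (m : ℕ) {u : ℝ} (hu : 0 ≤ u) :
    1 - erlangTail m u ≤ u ^ m / m.factorial := by
  cases m with
  | zero => simp [erlangTail]
  | succ m =>
    have hd : ∀ u : ℝ, HasDerivAt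
        (fun u => u ^ (m + 1) / ((m + 1).factorial : ℝ) - 1 + erlangTail (m + 1) u)
        (u ^ m / m.factorial * (1 - Real.exp (-u))) u := by
      intro u
      refine ((((hasDerivAt_pow (m + 1) u).div_const _).sub_const 1).add
        (hasDerivAt_erlangTail_succ m u)).congr_deriv ?_
      have : (m.factorial : ℝ) ≠ 0 := by positivity
      rw [Nat.factorial_succ]
      push_cast
      field_simp
      ring
    have hmono : MonotoneOn
        (fun u => u ^ (m + 1) / ((m + 1).factorial : ℝ) - 1 + erlangTail (m + 1) u)
        (Set.Ici 0) := by
      refine monotoneOn_of_deriv_nonneg (convex_Ici 0)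
        (fun u _ => (hd u).continuousAt.continuousWithinAt)
        (fun u _ => (hd u).differentiableAt.differentiableWithinAt) ?_
      intro u hu
      rw [interior_Ici, Set.mem_Ioi] at hu
      rw [(hd u).deriv]
      have : Real.exp (-u) ≤ 1 := Real.exp_le_one_iff.2 (by linarith)
      exact mul_nonneg (by positivity) (by linarith)
    have := hmono Set.self_mem_Ici hu hu
    simp only [erlangTail_succ_zero] at this
    simp at this
    linarith

/-- A sum of `m` standard exponential variables is at least their maximum. -/
theorem one_sub_erlangTail_le (m : ℕ) {u : ℝ} (hu : 0 ≤ u) :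
    1 - erlangTail m u ≤ (1 - Real.exp (-u)) ^ m := by
  induction m with
  | zero => simp [erlangTail]
  | succ m ih =>
    have h1 := one_sub_erlangTail_le_pow_div m hu
    have h2 : Real.exp (-u) ≤ 1 := Real.exp_le_one_iff.2 (by linarith)
    have h3 : erlangTail (m + 1) u = erlangTail m u + u ^ m / m.factorial * Real.exp (-u) := by
      simp [erlangTail, Finset.sum_range_succ]
    rw [pow_succ, h3]
    -- With `F = 1 - erlangTail m u`, the left side is `F (1 - e^{-u}) + e^{-u} (F - u^m / m!)`,
    -- whose last term is nonpositive by `h1`.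
    have h4 := mul_le_mul_of_nonneg_right ih (sub_nonneg.2 h2)
    have h5 := mul_le_mul_of_nonneg_right h1 (Real.exp_nonneg (-u))
    nlinarith

theorem integral_exp_neg_mul_zero_one {v : ℝ} (hv : 0 < v) :
    ∫ t in Set.Ioc (0 : ℝ) 1, Real.exp (-(v * t)) = (1 - Real.exp (-v)) / v := by
  rw [← intervalIntegral.integral_of_le zero_le_one]
  have hd : ∀ t : ℝ, HasDerivAt (fun t => -Real.exp (-(v * t)) / v) (Real.exp (-(v * t))) t := by
    intro t
    refine (((((hasDerivAt_id t).const_mul v).neg.exp).neg).div_const v).congr_deriv ?_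
    field_simp
    simp
  rw [intervalIntegral.integral_eq_sub_of_hasDerivAt (fun t _ => hd t)
    (Continuous.intervalIntegrable (by fun_prop) _ _)]
  simp
  ring

/-- Jensen's inequality for the averages of `exp (-v t)` over the unit interval. -/
theorem mul_log_one_sub_exp_div_le {w u : ℝ} (hw : 0 < w) (hwu : w ≤ u) :
    u * Real.log ((1 - Real.exp (-w)) / w) ≤ w * Real.log ((1 - Real.exp (-u)) / u) := by
  have hu : 0 < u := hw.trans_le hwu
  have hpos : ∀ v : ℝ, 0 < v → 0 < (1 - Real.exp (-v)) / v := fun v hv =>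
    div_pos (sub_pos.2 (Real.exp_lt_one_iff.2 (by linarith))) hv
  have hq : 1 ≤ u / w := (one_le_div hw).2 hwu
  have : IsProbabilityMeasure (volume.restrict (Set.Ioc (0 : ℝ) 1)) := ⟨by simp⟩
  have hint : ∀ v : ℝ, Integrable (fun t : ℝ => Real.exp (-(v * t)))
      (volume.restrict (Set.Ioc (0 : ℝ) 1)) := fun v =>
    (Continuous.integrableOn_Icc (by fun_prop)).mono_set Set.Ioc_subset_Icc_self
  have hrw : ∀ t : ℝ, Real.exp (-(w * t)) ^ (u / w) = Real.exp (-(u * t)) := by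
    intro t
    rw [← Real.exp_mul]
    congr 1
    field_simp
  -- Raising to the power `u / w ≥ 1` is convex and sends `exp (-w t)` to `exp (-u t)`.
  have key := (convexOn_rpow hq).map_integral_le (μ := volume.restrict (Set.Ioc (0 : ℝ) 1))
    (f := fun t => Real.exp (-(w * t)))
    (Real.continuous_rpow_const (by positivity)).continuousOn isClosed_Ici
    (ae_of_all _ fun t => (Real.exp_nonneg _)) (hint w)
    ((hint u).congr (ae_of_all _ fun t => (hrw t).symm))
  simp only [hrw, integral_exp_neg_mul_zero_one hw, integral_exp_neg_mul_zero_one hu] at key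
  have h2 := Real.log_le_log (Real.rpow_pos_of_pos (hpos w hw) _) key
  rw [Real.log_rpow (hpos w hw), div_mul_eq_mul_div, div_le_iff₀ hw] at h2
  linarith

/-- **Alzer's inequality** for the incomplete gamma function of integer shape. -/
theorem one_sub_exp_pow_le_one_sub_erlangTail (n : ℕ) {c : ℝ} (hc : 0 < c)
    (hcn : c ^ (n + 1) * (n + 1).factorial = 1) {u : ℝ} (hu : 0 ≤ u) :
    (1 - Real.exp (-(c * u))) ^ (n + 1) ≤ 1 - erlangTail (n + 1) u := by
  set f : ℝ → ℝ := fun u => 1 - erlangTail (n + 1) u - (1 - Real.exp (-(c * u))) ^ (n + 1) with hf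
  set g : ℝ → ℝ := fun v => (1 - Real.exp (-v)) / v with hg
  have hgpos : ∀ v : ℝ, 0 < v → 0 < g v := fun v hv =>
    div_pos (sub_pos.2 (Real.exp_lt_one_iff.2 (by linarith))) hv
  have hn : (n.factorial : ℝ) ≠ 0 := by positivity
  have hd : ∀ u : ℝ, 0 < u → HasDerivAt f
      (u ^ n / n.factorial * (Real.exp (-u) - g (c * u) ^ n * Real.exp (-(c * u)))) u := by
    intro u hu
    have h1 : HasDerivAt (fun u : ℝ => 1 - Real.exp (-(c * u))) (c * Real.exp (-(c * u))) u := by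
      refine ((((hasDerivAt_id u).const_mul c).neg.exp).const_sub 1).congr_deriv ?_
      simp; ring
    refine (((hasDerivAt_erlangTail_succ n u).const_sub 1).sub (h1.pow (n + 1))).congr_deriv ?_
    have h2 : (1 - Real.exp (-(c * u))) = (c * u) * g (c * u) := by
      rw [hg]; field_simp
    have h3 : c ^ (n + 1) * ((n + 1) * n.factorial) = 1 := by
      refine Eq.trans ?_ hcn
      rw [Nat.factorial_succ]; push_cast; ring
    simp only [Nat.add_sub_cancel]
    rw [h2, mul_pow, mul_pow]
    -- The normalisation of `c` equalises the prefactors of the two derivatives, so that the sign of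
    -- `f'` only depends on comparing `e^{-u}` with `g(cu)^n e^{-cu}`.
    have h4 : (n + 1 : ℝ) * c ^ (n + 1) = 1 / n.factorial := by
      rw [eq_div_iff hn]; linarith
    calc _ = u ^ n / n.factorial * Real.exp (-u)
        - ((n + 1 : ℝ) * c ^ (n + 1)) * u ^ n * g (c * u) ^ n * Real.exp (-(c * u)) := by
          push_cast; ring
      _ = _ := by rw [h4]; ring
  have hcont : Continuous f := by
    have := continuous_erlangTail (n + 1)
    fun_prop
  -- the sign of the derivative changes at most once, from `+` to `-`
  have hdown : ∀ w u : ℝ, 0 < w → w ≤ u →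
      g (c * u) ^ n * Real.exp (-(c * u)) ≤ Real.exp (-u) →
      g (c * w) ^ n * Real.exp (-(c * w)) ≤ Real.exp (-w) := by
    intro w u hw hwu h
    have hu : 0 < u := hw.trans_le hwu
    have hlog : ∀ v : ℝ, 0 < v → (g (c * v) ^ n * Real.exp (-(c * v)) ≤ Real.exp (-v) ↔
        n * Real.log (g (c * v)) - c * v ≤ -v) := by
      intro v hv
      have := hgpos (c * v) (by positivity)
      rw [← Real.log_le_log_iff (by positivity) (Real.exp_pos _), Real.log_mul (by positivity)
        (Real.exp_ne_zero _), Real.log_pow, Real.log_exp, Real.log_exp]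
      rfl
    rw [hlog u hu] at h
    rw [hlog w hw]
    -- After division by `v`, the condition reads `n log g(cv) / v ≤ c - 1`. Jensen says that the
    -- left side is nondecreasing in `v`, so the condition passes from `u` down to `w`.
    have hJ := mul_log_one_sub_exp_div_le (mul_pos hc hw) (mul_le_mul_of_nonneg_left hwu hc.le)
    change c * u * Real.log (g (c * w)) ≤ c * w * Real.log (g (c * u)) at hJ
    have hJ' : u * Real.log (g (c * w)) ≤ w * Real.log (g (c * u)) := by
      refine le_of_mul_le_mul_left ?_ hc
      linarith
    have h5 := mul_le_mul_of_nonneg_left hJ' (Nat.cast_nonneg (α := ℝ) n)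
    have h6 := mul_le_mul_of_nonneg_left h hw.le
    refine le_of_mul_le_mul_left ?_ hu
    linarith
  have hf0 : f 0 = 0 := by simp [hf, erlangTail_succ_zero]
  have hftop : Tendsto f atTop (𝓝 0) := by
    have h1 : Tendsto (fun u : ℝ => Real.exp (-(c * u))) atTop (𝓝 0) :=
      Real.tendsto_exp_neg_atTop_nhds_zero.comp (tendsto_id.const_mul_atTop hc)
    have h2 := ((tendsto_erlangTail_atTop (n + 1)).const_sub 1).sub ((h1.const_sub 1).pow (n + 1))
    simpa using h2
  suffices 0 ≤ f u by simp only [hf] at this; linarith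
  rcases hu.eq_or_lt with rfl | hu
  · exact hf0.ge
  -- If `f'(u) ≥ 0`, then `f` increases on `[0, u]` from the value `0`; otherwise `f` decreases on
  -- `[u, ∞)` to the limit `0`. Both give `f u ≥ 0`.
  by_cases h : g (c * u) ^ n * Real.exp (-(c * u)) ≤ Real.exp (-u)
  · have hmono : MonotoneOn f (Set.Icc 0 u) := by
      refine monotoneOn_of_deriv_nonneg (convex_Icc 0 u) hcont.continuousOn
        (fun w hw => ?_) (fun w hw => ?_)
      all_goals rw [interior_Icc] at hw
      · exact (hd w hw.1).differentiableAt.differentiableWithinAt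
      · rw [(hd w hw.1).deriv]
        have := hdown w u hw.1 hw.2.le h
        have := hw.1
        exact mul_nonneg (by positivity) (by linarith)
    rw [← hf0]
    exact hmono (Set.left_mem_Icc.2 hu.le) (Set.right_mem_Icc.2 hu.le) hu.le
  · have hanti : AntitoneOn f (Set.Ici u) := by
      refine antitoneOn_of_deriv_nonpos (convex_Ici u) hcont.continuousOn
        (fun w hw => ?_) (fun w hw => ?_)
      all_goals
        rw [interior_Ici, Set.mem_Ioi] at hw
        have hw0 : 0 < w := hu.trans hw
      · exact (hd w hw0).differentiableAt.differentiableWithinAt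
      · rw [(hd w hw0).deriv]
        have : ¬ g (c * w) ^ n * Real.exp (-(c * w)) ≤ Real.exp (-w) :=
          fun h' => h (hdown u w hu hw.le h')
        exact mul_nonpos_of_nonneg_of_nonpos (by positivity) (by linarith)
    refine le_of_tendsto hftop ?_
    filter_upwards [eventually_ge_atTop u] with w hw
    exact hanti Set.self_mem_Ici hw hw

/-! ### Gamma laws and independence -/

/-- The tail of the gamma distribution of integer shape. -/
theorem gammaMeasure_Ioi (n : ℕ) {ρ t : ℝ} (hρ : 0 < ρ) (ht : 0 ≤ t) :
    gammaMeasure (n + 1 : ℕ) ρ (Set.Ioi t) = ENNReal.ofReal (erlangTail (n + 1) (ρ * t)) := by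
  have hd : ∀ x : ℝ, HasDerivAt (fun x => -erlangTail (n + 1) (ρ * x))
      (ρ ^ (n + 1) / n.factorial * x ^ n * Real.exp (-(ρ * x))) x := by
    intro x
    refine ((hasDerivAt_erlangTail_succ n (ρ * x)).comp x
      ((hasDerivAt_id x).const_mul ρ)).neg.congr_deriv ?_
    simp only [mul_one]
    ring
  have hlim : Tendsto (fun x => -erlangTail (n + 1) (ρ * x)) atTop (𝓝 0) := by
    simpa using ((tendsto_erlangTail_atTop (n + 1)).comp (tendsto_id.const_mul_atTop hρ)).neg
  have hnn : ∀ x ∈ Set.Ioi t, 0 ≤ ρ ^ (n + 1) / n.factorial * x ^ n * Real.exp (-(ρ * x)) := by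
    intro x hx
    have : 0 < x := ht.trans_lt hx
    positivity
  have hI := integral_Ioi_of_hasDerivAt_of_nonneg' (fun x _ => hd x) hnn hlim
  have hint := integrableOn_Ioi_deriv_of_nonneg' (fun x _ => hd x) hnn hlim
  rw [gammaMeasure, withDensity_apply _ measurableSet_Ioi]
  have : ∫⁻ x in Set.Ioi t, gammaPDF (n + 1 : ℕ) ρ x = ∫⁻ x in Set.Ioi t,
      ENNReal.ofReal (ρ ^ (n + 1) / n.factorial * x ^ n * Real.exp (-(ρ * x))) := by
    refine setLIntegral_congr_fun measurableSet_Ioi fun x hx => ?_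
    rw [gammaPDF_of_nonneg (ht.trans (le_of_lt hx))]
    congr 3
    · rw [Real.rpow_natCast]
      push_cast
      rw [Real.Gamma_nat_eq_factorial]
    · push_cast
      rw [add_sub_cancel_right, Real.rpow_natCast]
  rw [this, ← ofReal_integral_eq_lintegral_ofReal hint
    ((ae_restrict_iff' measurableSet_Ioi).2 (ae_of_all _ hnn)), hI]
  simp

/-- If `f` is independent of `g` and the pair `(f, g)` is independent of `h`, then `f` is
independent of the pair `(g, h)`. -/
theorem ProbabilityTheory.IndepFun.prodMk_right_of_prodMk_left {Ω α β γ : Type*}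
    [MeasurableSpace Ω] [MeasurableSpace α] [MeasurableSpace β] [MeasurableSpace γ]
    {μ : Measure Ω} [IsProbabilityMeasure μ] {f : Ω → α} {g : Ω → β} {h : Ω → γ}
    (hf : Measurable f) (hg : Measurable g) (hh : Measurable h)
    (hfg : IndepFun f g μ) (hfgh : IndepFun (fun ω => (f ω, g ω)) h μ) :
    IndepFun f (fun ω => (g ω, h ω)) μ := by
  have := Measure.isProbabilityMeasure_map (μ := μ) hf.aemeasurable
  have := Measure.isProbabilityMeasure_map (μ := μ) hg.aemeasurable
  have := Measure.isProbabilityMeasure_map (μ := μ) hh.aemeasurable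
  have hgh : IndepFun g h μ := hfgh.comp measurable_snd measurable_id
  rw [indepFun_iff_map_prod_eq_prod_map_map (by fun_prop) (by fun_prop)] at hfg hfgh hgh ⊢
  -- The joint law is the triple product of the marginals, whichever way it is bracketed.
  rw [hgh, ← Measure.prodAssoc_prod, ← hfg, ← hfgh, Measure.map_map (by fun_prop) (by fun_prop)]
  rfl

/-- In an independent sequence, the first term is independent of the sequence of later terms. -/
theorem ProbabilityTheory.iIndepFun.indepFun_zero_succ {Ω α : Type*} [MeasurableSpace Ω]
    [MeasurableSpace α] {μ : Measure Ω} {f : ℕ → Ω → α} (hf : ∀ i, Measurable (f i))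
    (h : iIndepFun f μ) : IndepFun (f 0) (fun ω i => f (i + 1) ω) μ := by
  have key := indep_iSup_of_disjoint (fun i => (hf i).comap_le) h
    (S := {0}) (T := Set.Ici 1) (by simp)
  refine (IndepFun_iff_Indep _ _ _).2 (indep_of_indep_of_le_right
    (indep_of_indep_of_le_left key ?_) ?_)
  · simp
  · rw [MeasurableSpace.pi, MeasurableSpace.comap_iSup]
    refine iSup_le fun i => ?_
    rw [MeasurableSpace.comap_comp]
    exact le_iSup₂_of_le (f := fun i (_ : i ∈ Set.Ici 1) => MeasurableSpace.comap (f i) _)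
      (i + 1) (by simp) le_rfl

/-- No summability is needed: for a divergent series both sides take the default value `0`. The
extended sum makes measurability of the interference immediate. -/
theorem Real.tsum_eq_toReal_tsum_ofReal {f : ℕ → ℝ} (hf : ∀ i, 0 ≤ f i) :
    ∑' i, f i = (∑' i, ENNReal.ofReal (f i)).toReal := by
  rw [ENNReal.tsum_toReal_eq (fun _ => ENNReal.ofReal_ne_top)]
  simp [ENNReal.toReal_ofReal (hf _)]

theorem gammaMeasure_ae_nonneg (a r : ℝ) : ∀ᵐ g ∂gammaMeasure a r, 0 ≤ g := by
  have : {x : ℝ | ¬ 0 ≤ x} = Set.Iio 0 := by ext; simp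
  rw [ae_iff, this, gammaMeasure, withDensity_apply _ measurableSet_Iio,
    lintegral_gammaPDF_of_nonpos le_rfl]

/-! ### The conditional law of the serving gain and the interference -/

namespace HetNet

variable {p : NetworkParams} {Ω : Type*} [MeasurableSpace Ω] {μ : Measure Ω}

theorem measurable_XL (N : HetNet p μ) (i : ℕ) : Measurable (N.XL i) := N.poisson_L.measurable i
theorem measurable_XN (N : HetNet p μ) (i : ℕ) : Measurable (N.XN i) := N.poisson_N.measurable i
theorem measurable_XT (N : HetNet p μ) (i : ℕ) : Measurable (N.XT i) := N.poisson_T.measurable i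

/-- Everything in the network except the gain of the serving LoS ABS. -/
def environment (N : HetNet p μ) (ω : Ω) :
    (((ℕ → ℝ) × (ℕ → ℝ)) × (ℕ → EuclideanSpace ℝ (Fin 2))) ×
      (ℕ → EuclideanSpace ℝ (Fin 2)) × (ℕ → EuclideanSpace ℝ (Fin 2)) :=
  ((((fun i => N.HL (i + 1) ω), fun i => N.HN i ω), fun i => N.XT i ω),
    (fun i => N.XN i ω), fun i => N.XL i ω)

theorem measurable_environment (N : HetNet p μ) : Measurable N.environment := by
  have h1 := N.measurable_XL
  have h2 := N.measurable_XN
  have h3 := N.measurable_XT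
  have h4 := N.measurable_HL
  have h5 := N.measurable_HN
  unfold environment
  fun_prop

/-- The families are adjoined one at a time, in the nested order in which the independence
assumptions are given: each new family is independent of the gain together with the families already
collected. -/
theorem indepFun_gain_environment [IsProbabilityMeasure μ] (N : HetNet p μ) :
    IndepFun (N.HL 0) N.environment μ := by
  have h1 := N.measurable_XL
  have h2 := N.measurable_XN
  have h3 := N.measurable_XT
  have h4 := N.measurable_HL
  have h5 := N.measurable_HN
  have a1 : IndepFun (N.HL 0) (fun ω i => N.HL (i + 1) ω) μ := N.indep_HL.indepFun_zero_succ h4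
  have a2 : IndepFun (N.HL 0) (fun ω => ((fun i => N.HL (i + 1) ω), fun i => N.HN i ω)) μ :=
    a1.prodMk_right_of_prodMk_left (by fun_prop) (by fun_prop) (by fun_prop)
      (N.indep_HL_HN.comp (φ := fun x : ℕ → ℝ => (x 0, fun i => x (i + 1)))
        (by fun_prop) measurable_id)
  have a3 : IndepFun (N.HL 0)
      (fun ω => (((fun i => N.HL (i + 1) ω), fun i => N.HN i ω), fun i => N.XT i ω)) μ :=
    a2.prodMk_right_of_prodMk_left (by fun_prop) (by fun_prop) (by fun_prop)
      (N.indep_XT.symm.comp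
        (φ := fun x : (ℕ → ℝ) × (ℕ → ℝ) => (x.1 0, ((fun i => x.1 (i + 1)), x.2)))
        (by fun_prop) measurable_id)
  have a4 : IndepFun (N.HL 0) (fun ω =>
      ((((fun i => N.HL (i + 1) ω), fun i => N.HN i ω), fun i => N.XT i ω), fun i => N.XN i ω)) μ :=
    a3.prodMk_right_of_prodMk_left (by fun_prop) (by fun_prop) (by fun_prop)
      (N.indep_XN.symm.comp
        (φ := fun x : (ℕ → EuclideanSpace ℝ (Fin 2)) × (ℕ → ℝ) × (ℕ → ℝ) =>
          (x.2.1 0, (((fun i => x.2.1 (i + 1)), x.2.2), x.1)))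
        (by fun_prop) measurable_id)
  have a5 := a4.prodMk_right_of_prodMk_left (h := fun ω i => N.XL i ω)
      (by fun_prop) (by fun_prop) (by fun_prop)
      (N.indep_XL.symm.comp
        (φ := fun x : (ℕ → EuclideanSpace ℝ (Fin 2)) × (ℕ → EuclideanSpace ℝ (Fin 2)) ×
            (ℕ → ℝ) × (ℕ → ℝ) =>
          (x.2.2.1 0, ((((fun i => x.2.2.1 (i + 1)), x.2.2.2), x.2.1), x.1)))
        (by fun_prop) measurable_id)
  exact a5.comp measurable_id (MeasurableEquiv.prodAssoc.measurable)

theorem ae_gain_nonneg (ν : Measure Ω) {H : Ω → ℝ} (hH : Measurable H) {a r : ℝ}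
    (h : ν.map H = gammaMeasure a r) : ∀ᵐ ω ∂ν, 0 ≤ H ω :=
  ae_of_ae_map (p := fun x => 0 ≤ x) hH.aemeasurable (h ▸ gammaMeasure_ae_nonneg a r)

/-- The aggregate interference as a function of the environment. -/
noncomputable def interfOfEnvironment (p : NetworkParams)
    (e : (((ℕ → ℝ) × (ℕ → ℝ)) × (ℕ → EuclideanSpace ℝ (Fin 2))) ×
      (ℕ → EuclideanSpace ℝ (Fin 2)) × (ℕ → EuclideanSpace ℝ (Fin 2))) : ℝ :=
  (∑' i, ENNReal.ofReal (p.PA * p.CL *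
      Real.sqrt (‖e.2.2 (i + 1)‖ ^ 2 + p.h ^ 2) ^ (-p.alphaL) * e.1.1.1 i)).toReal +
    (∑' i, ENNReal.ofReal (p.PA * p.CN *
      Real.sqrt (‖e.2.1 i‖ ^ 2 + p.h ^ 2) ^ (-p.alphaN) * e.1.1.2 i)).toReal

theorem measurable_interfOfEnvironment (p : NetworkParams) :
    Measurable (interfOfEnvironment p) := by
  unfold interfOfEnvironment
  fun_prop

theorem interfOfEnvironment_nonneg (p : NetworkParams)
    (e : (((ℕ → ℝ) × (ℕ → ℝ)) × (ℕ → EuclideanSpace ℝ (Fin 2))) ×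
      (ℕ → EuclideanSpace ℝ (Fin 2)) × (ℕ → EuclideanSpace ℝ (Fin 2))) :
    0 ≤ interfOfEnvironment p e :=
  add_nonneg ENNReal.toReal_nonneg ENNReal.toReal_nonneg

/-- Only almost sure, since the gamma law makes the gains nonnegative only almost surely. -/
theorem interfA_ae_eq (hp : p.Admissible) (N : HetNet p μ) :
    N.interfA =ᵐ[μ] fun ω => interfOfEnvironment p (N.environment ω) := by
  have hL := ae_all_iff.2 fun i => ae_gain_nonneg μ (N.measurable_HL i) (N.law_HL i)
  have hN := ae_all_iff.2 fun i => ae_gain_nonneg μ (N.measurable_HN i) (N.law_HN i)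
  filter_upwards [hL, hN] with ω h1 h2
  have := hp.PA_pos
  have := hp.CL_pos
  have := hp.CN_pos
  unfold interfA interfL interfN distL distN
  rw [Real.tsum_eq_toReal_tsum_ofReal fun i => mul_nonneg (by positivity) (h1 (i + 1)),
    Real.tsum_eq_toReal_tsum_ofReal fun i => mul_nonneg (by positivity) (h2 i)]
  rfl

theorem measurable_distL (N : HetNet p μ) (i : ℕ) : Measurable (N.distL i) := by
  have := N.measurable_XL
  unfold distL
  fun_prop

/-- The association event depends on the environment only. -/
theorem exists_assocLoS_eq_preimage (N : HetNet p μ) :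
    ∃ A, MeasurableSet A ∧ N.assocLoS = N.environment ⁻¹' A := by
  refine ⟨{e | p.etaN * Real.sqrt (‖e.2.1 0‖ ^ 2 + p.h ^ 2) ^ (-p.alphaN) <
      p.etaL * Real.sqrt (‖e.2.2 0‖ ^ 2 + p.h ^ 2) ^ (-p.alphaL)} ∩
    {e | p.etaT * ‖e.1.2 0‖ ^ (-p.alphaT) * (if ‖e.1.2 0‖ ≤ p.RB then 1 else 0) <
      p.etaL * Real.sqrt (‖e.2.2 0‖ ^ 2 + p.h ^ 2) ^ (-p.alphaL)}, ?_, rfl⟩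
  refine (measurableSet_lt (by fun_prop) (by fun_prop)).inter
    (measurableSet_lt (Measurable.mul (by fun_prop) ?_) (by fun_prop))
  exact Measurable.ite (measurableSet_le (by fun_prop) measurable_const)
    measurable_const measurable_const

theorem lawLoS_absolutelyContinuous (N : HetNet p μ) : N.lawLoS ≪ μ :=
  cond_absolutelyContinuous

/-- Conditioning on an event of the environment restricts and rescales the second factor of a
product law and leaves the first untouched. -/
theorem map_gain_environment_lawLoS [IsProbabilityMeasure μ] (N : HetNet p μ) :
    N.lawLoS.map (fun ω => (N.HL 0 ω, N.environment ω)) =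
      (gammaMeasure p.mL p.mL).prod (N.lawLoS.map N.environment) := by
  obtain ⟨A, hA, hAe⟩ := N.exists_assocLoS_eq_preimage
  have h0 := N.measurable_HL 0
  have he := N.measurable_environment
  have hrestr : (μ.restrict N.assocLoS).map N.environment = (μ.map N.environment).restrict A := by
    rw [hAe, Measure.restrict_map he hA]
  have hind := (indepFun_iff_map_prod_eq_prod_map_map h0.aemeasurable he.aemeasurable).1
    N.indepFun_gain_environment
  have : SFinite (gammaMeasure p.mL p.mL) := by rw [← N.law_HL 0]; infer_instance
  unfold lawLoS ProbabilityTheory.cond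
  rw [Measure.map_smul, Measure.map_smul, Measure.prod_smul_right, hrestr]
  congr 1
  have h2 : N.assocLoS = (fun ω => (N.HL 0 ω, N.environment ω)) ⁻¹' (Set.univ ×ˢ A) := by
    rw [hAe]; ext; simp
  rw [h2, ← Measure.restrict_map (by fun_prop) (MeasurableSet.univ.prod hA), hind, N.law_HL 0,
    ← Measure.prod_restrict, Measure.restrict_univ]

/-- The gain is independent of the pair (distance, interference) under the conditioned law, so
disintegrating along the distance affects the interference alone. Almost everywhere uniqueness of
conditional distributions identifies the product kernel. -/
theorem condLawGainInterf_ae_eq [IsProbabilityMeasure μ] (hp : p.Admissible) (N : HetNet p μ) :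
    ∀ᵐ r ∂(N.lawLoS.map (N.distL 0)),
      N.condLawGainInterf r = (gammaMeasure p.mL p.mL).prod (N.condLawInterf r) := by
  have h0 := N.measurable_HL 0
  have he := N.measurable_environment
  have hD := N.measurable_distL 0
  have hI := measurable_interfOfEnvironment p
  set J : Ω → ℝ := fun ω => interfOfEnvironment p (N.environment ω) with hJdef
  have hJ : Measurable J := hI.comp he
  have hIJ : N.interfA =ᵐ[N.lawLoS] J := N.lawLoS_absolutelyContinuous.ae_eq (N.interfA_ae_eq hp)
  have hGIJ : (fun ω => (N.HL 0 ω, N.interfA ω)) =ᵐ[N.lawLoS] fun ω => (N.HL 0 ω, J ω) := by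
    filter_upwards [hIJ] with ω h
    rw [h]
  have : IsProbabilityMeasure (gammaMeasure p.mL p.mL) :=
    isProbabilityMeasure_gammaMeasure (by exact_mod_cast hp.mL_pos) (by exact_mod_cast hp.mL_pos)
  unfold condLawGainInterf condLawInterf
  rw [condDistrib_congr_left hIJ, condDistrib_congr_left hGIJ]
  set κ := condDistrib J (N.distL 0) N.lawLoS with hκ
  have key : N.lawLoS.map (fun ω => (N.HL 0 ω, (N.distL 0 ω, J ω))) =
      (gammaMeasure p.mL p.mL).prod (N.lawLoS.map fun ω => (N.distL 0 ω, J ω)) := by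
    have hφ : Measurable fun e : (((ℕ → ℝ) × (ℕ → ℝ)) × (ℕ → EuclideanSpace ℝ (Fin 2))) ×
        (ℕ → EuclideanSpace ℝ (Fin 2)) × (ℕ → EuclideanSpace ℝ (Fin 2)) =>
        (Real.sqrt (‖e.2.2 0‖ ^ 2 + p.h ^ 2), interfOfEnvironment p e) := by fun_prop
    have h1 := congrArg (Measure.map (Prod.map id fun e =>
      (Real.sqrt (‖e.2.2 0‖ ^ 2 + p.h ^ 2), interfOfEnvironment p e)))
      N.map_gain_environment_lawLoS
    rw [Measure.map_map (by fun_prop) (by fun_prop), ← Measure.map_prod_map _ _ measurable_id hφ,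
      Measure.map_id, Measure.map_map hφ he] at h1
    exact h1
  have main : condDistrib (fun ω => (N.HL 0 ω, J ω)) (N.distL 0) N.lawLoS
      =ᵐ[N.lawLoS.map (N.distL 0)] (Kernel.const ℝ (gammaMeasure p.mL p.mL)) ×ₖ κ := by
    refine condDistrib_ae_eq_of_measure_eq_compProd _ (by fun_prop) ?_
    have h1 : N.lawLoS.map (fun ω => (N.distL 0 ω, (N.HL 0 ω, J ω))) =
        (N.lawLoS.map (fun ω => (N.HL 0 ω, (N.distL 0 ω, J ω)))).map
          (fun q => (q.2.1, (q.1, q.2.2))) := by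
      rw [Measure.map_map (by fun_prop) (by fun_prop)]
      rfl
    rw [h1, key, ← compProd_map_condDistrib hJ.aemeasurable]
    refine Measure.ext_of_lintegral _ fun f hf => ?_
    rw [lintegral_map hf (by fun_prop), lintegral_prod _ (by fun_prop),
      Measure.lintegral_compProd hf]
    have h2 : ∀ x : ℝ, ∫⁻ y, f (y.1, x, y.2) ∂((N.lawLoS.map (N.distL 0)) ⊗ₘ κ) =
        ∫⁻ d, ∫⁻ j, f (d, x, j) ∂κ d ∂(N.lawLoS.map (N.distL 0)) := fun x =>
      Measure.lintegral_compProd (f := fun y : ℝ × ℝ => f (y.1, x, y.2)) (by fun_prop)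
    simp only [← hκ, h2]
    -- Tonelli moves the distance outside the gain, matching the order of the disintegration.
    rw [lintegral_lintegral_swap]
    · refine lintegral_congr fun d => ?_
      rw [Kernel.prod_apply, Kernel.const_apply, lintegral_prod _ (by fun_prop)]
    · refine Measurable.aemeasurable ?_
      refine Measurable.lintegral_kernel_prod_right' (κ := Kernel.prodMkLeft ℝ κ)
        (f := fun q : (ℝ × ℝ) × ℝ => f (q.1.2, q.1.1, q.2)) (by fun_prop)
  filter_upwards [main] with r hr
  rw [hr, Kernel.prod_apply, Kernel.const_apply]

theorem condLawInterf_ae_nonneg [IsProbabilityMeasure μ] (hp : p.Admissible) (N : HetNet p μ) :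
    ∀ᵐ r ∂(N.lawLoS.map (N.distL 0)), ∀ᵐ y ∂(N.condLawInterf r), 0 ≤ y := by
  have hD := N.measurable_distL 0
  have hIJ := N.lawLoS_absolutelyContinuous.ae_eq (N.interfA_ae_eq hp)
  have hI : AEMeasurable N.interfA N.lawLoS :=
    ⟨_, (measurable_interfOfEnvironment p).comp N.measurable_environment, hIJ⟩
  unfold condLawInterf
  refine Measure.ae_ae_of_ae_compProd (p := fun x : ℝ × ℝ => 0 ≤ x.2) ?_
  rw [compProd_map_condDistrib hI,
    ae_map_iff (by fun_prop) (measurableSet_le measurable_const measurable_snd)]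
  filter_upwards [hIJ] with ω h
  rw [h]
  exact interfOfEnvironment_nonneg p _

theorem distL_pos (hp : p.Admissible) (N : HetNet p μ) (i : ℕ) (ω : Ω) : 0 < N.distL i ω := by
  have := hp.h_pos
  unfold distL
  positivity

end HetNet

/-! ### Expected tails of a nonnegative random variable -/

theorem erlangTail_le_one {m : ℕ} (hm : 0 < m) {u : ℝ} (hu : 0 ≤ u) : erlangTail m u ≤ 1 := by
  obtain ⟨n, rfl⟩ := Nat.exists_eq_succ_of_ne_zero hm.ne'
  rw [← erlangTail_succ_zero n]
  exact antitoneOn_erlangTail _ Set.self_mem_Ici hu hu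

/-- The exponential dominates: `(s y)^j / j! ≤ e^{s y}` bounds the integrand, so the interference
itself need not have finite moments. -/
theorem integrable_exp_neg_mul_mul_pow {ν : Measure ℝ} [IsFiniteMeasure ν]
    (hν : ∀ᵐ y ∂ν, 0 ≤ y) {s : ℝ} (hs : 0 < s) (j : ℕ) :
    Integrable (fun y => Real.exp (-s * y) * y ^ j) ν := by
  refine Integrable.of_bound (by fun_prop) (j.factorial / s ^ j) ?_
  filter_upwards [hν] with y hy
  rw [Real.norm_of_nonneg (by positivity), neg_mul, Real.exp_neg,
    inv_mul_le_iff₀ (Real.exp_pos _)]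
  have h := Real.pow_div_factorial_le_exp (s * y) (by positivity) j
  rw [div_le_iff₀ (by positivity), mul_pow] at h
  rw [mul_div_assoc', le_div_iff₀ (by positivity)]
  linarith

/-- The expected Erlang tail at a multiple of a shifted random variable, expanded by the binomial
theorem. -/
theorem integral_erlangTail_mul_add {ν : Measure ℝ} [IsFiniteMeasure ν]
    (hν : ∀ᵐ y ∂ν, 0 ≤ y) (m : ℕ) {s : ℝ} (hs : 0 < s) (a : ℝ) :
    ∫ y, erlangTail m (s * (y + a)) ∂ν =
      ∑ k ∈ Finset.range m, ∑ q ∈ Finset.range (k + 1),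
        (k.choose q : ℝ) * (s ^ k / k.factorial) * Real.exp (-s * a) * a ^ q *
          ∫ y, Real.exp (-s * y) * y ^ (k - q) ∂ν := by
  have hpt : ∀ y : ℝ, erlangTail m (s * (y + a)) =
      ∑ k ∈ Finset.range m, ∑ q ∈ Finset.range (k + 1),
        (k.choose q : ℝ) * (s ^ k / k.factorial) * Real.exp (-s * a) * a ^ q *
          (Real.exp (-s * y) * y ^ (k - q)) := by
    intro y
    refine Finset.sum_congr rfl fun k _ => ?_
    have h1 : Real.exp (-(s * (y + a))) = Real.exp (-s * a) * Real.exp (-s * y) := by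
      rw [← Real.exp_add]; congr 1; ring
    -- The shift `a` is put first so that the summation index becomes its exponent.
    rw [mul_pow, add_comm y a, add_pow, add_comm a y, h1, Finset.mul_sum, Finset.sum_div,
      Finset.sum_mul]
    refine Finset.sum_congr rfl fun q _ => ?_
    ring
  simp only [hpt]
  have hint := fun j => integrable_exp_neg_mul_mul_pow hν hs j
  rw [integral_finsetSum _ fun k _ => integrable_finsetSum _ fun q _ => (hint _).const_mul _]
  refine Finset.sum_congr rfl fun k _ => ?_
  rw [integral_finsetSum _ fun q _ => (hint _).const_mul _]
  exact Finset.sum_congr rfl fun q _ => integral_const_mul _ _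

theorem one_sub_one_sub_pow (m : ℕ) (x : ℝ) :
    1 - (1 - x) ^ m = ∑ k ∈ Finset.Icc 1 m, (-1) ^ (k + 1) * (m.choose k : ℝ) * x ^ k := by
  have h1 : (1 - x) ^ m = ∑ k ∈ Finset.range (m + 1), (-1) ^ k * (m.choose k : ℝ) * x ^ k := by
    rw [sub_eq_add_neg, add_comm, add_pow]
    refine Finset.sum_congr rfl fun k _ => ?_
    rw [neg_pow]; ring
  rw [h1, Finset.sum_range_succ']
  have h2 : Finset.Icc 1 m = Finset.Ico (0 + 1) (m + 1) := by ext; simp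
  -- The term `k = 0` cancels the leading `1`; the others are reindexed to start at `1`.
  rw [h2, ← Finset.sum_Ico_add' , ← Finset.range_eq_Ico]
  simp only [pow_zero, Nat.choose_zero_right, Nat.cast_one, mul_one, sub_add_cancel_right]
  rw [← Finset.sum_neg_distrib]
  refine Finset.sum_congr rfl fun k _ => ?_
  ring

theorem integrable_exp_neg_mul {ν : Measure ℝ} [IsFiniteMeasure ν]
    (hν : ∀ᵐ y ∂ν, 0 ≤ y) {s : ℝ} (hs : 0 ≤ s) : Integrable (fun y => Real.exp (-s * y)) ν := by
  refine Integrable.of_bound (by fun_prop) 1 ?_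
  filter_upwards [hν] with y hy
  rw [Real.norm_of_nonneg (by positivity)]
  exact Real.exp_le_one_iff.2 (by nlinarith)

theorem integral_one_sub_one_sub_exp_pow {ν : Measure ℝ} [IsFiniteMeasure ν]
    (hν : ∀ᵐ y ∂ν, 0 ≤ y) (m : ℕ) {s : ℝ} (hs : 0 ≤ s) (a : ℝ) :
    ∫ y, (1 - (1 - Real.exp (-(s * (y + a)))) ^ m) ∂ν =
      ∑ k ∈ Finset.Icc 1 m, (-1) ^ (k + 1) * (m.choose k : ℝ) * Real.exp (-(k * s * a)) *
        ∫ y, Real.exp (-(k * s) * y) ∂ν := by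
  simp only [one_sub_one_sub_pow]
  have hpt : ∀ (y : ℝ) (k : ℕ), (-1) ^ (k + 1) * (m.choose k : ℝ) *
      Real.exp (-(s * (y + a))) ^ k = (-1) ^ (k + 1) * (m.choose k : ℝ) *
        Real.exp (-(k * s * a)) * Real.exp (-(k * s) * y) := by
    intro y k
    rw [← Real.exp_nat_mul, mul_assoc _ (Real.exp _), ← Real.exp_add]
    congr 2
    ring
  simp only [hpt]
  rw [integral_finsetSum _ fun (k : ℕ) _ =>
    (integrable_exp_neg_mul hν (s := k * s) (by positivity)).const_mul _]
  exact Finset.sum_congr rfl fun q _ => integral_const_mul _ _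

theorem one_sub_one_sub_exp_pow_mem_Icc (m : ℕ) {u : ℝ} (hu : 0 ≤ u) :
    1 - (1 - Real.exp (-u)) ^ m ∈ Set.Icc (0 : ℝ) 1 := by
  have h1 : Real.exp (-u) ≤ 1 := Real.exp_le_one_iff.2 (by linarith)
  have h2 := Real.exp_pos (-u)
  have h3 : (1 - Real.exp (-u)) ^ m ≤ 1 := pow_le_one₀ (by linarith) (by linarith)
  have h4 : 0 ≤ (1 - Real.exp (-u)) ^ m := pow_nonneg (by linarith) m
  exact ⟨by linarith, by linarith⟩

theorem integrable_one_sub_one_sub_exp_pow {ν : Measure ℝ} [IsFiniteMeasure ν]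
    (hν : ∀ᵐ y ∂ν, 0 ≤ y) (m : ℕ) {s a : ℝ} (hs : 0 ≤ s) (ha : 0 ≤ a) :
    Integrable (fun y => 1 - (1 - Real.exp (-(s * (y + a)))) ^ m) ν := by
  refine Integrable.of_bound (by fun_prop) 1 ?_
  filter_upwards [hν] with y hy
  have h := one_sub_one_sub_exp_pow_mem_Icc m (u := s * (y + a)) (by positivity)
  rw [Real.norm_of_nonneg h.1]
  exact h.2

theorem integrable_erlangTail_mul_add {ν : Measure ℝ} [IsFiniteMeasure ν]
    (hν : ∀ᵐ y ∂ν, 0 ≤ y) {m : ℕ} (hm : 0 < m) {s a : ℝ} (hs : 0 ≤ s) (ha : 0 ≤ a) :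
    Integrable (fun y => erlangTail m (s * (y + a))) ν := by
  refine Integrable.of_bound
    ((continuous_erlangTail m).comp (by fun_prop)).aestronglyMeasurable 1 ?_
  filter_upwards [hν] with y hy
  rw [Real.norm_of_nonneg (erlangTail_nonneg _ (by positivity))]
  exact erlangTail_le_one hm (by positivity)

/-- As `y ≥ 0`, the integrand is at most its value at `y = 0`, which tends to `0` because `a > 0`.
-/
theorem tendsto_integral_erlangTail {ν : Measure ℝ} [IsProbabilityMeasure ν]
    (hν : ∀ᵐ y ∂ν, 0 ≤ y) {m : ℕ} (hm : 0 < m) {a : ℝ} (ha : 0 < a) :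
    Tendsto (fun s => ∫ y, erlangTail m (s * (y + a)) ∂ν) atTop (𝓝 0) := by
  refine squeeze_zero' ?_ ?_
    ((tendsto_erlangTail_atTop m).comp (tendsto_id.atTop_mul_const ha))
  · filter_upwards [eventually_ge_atTop 0] with s hs
    refine integral_nonneg_of_ae ?_
    filter_upwards [hν] with y hy
    exact erlangTail_nonneg _ (by positivity)
  · filter_upwards [eventually_ge_atTop 0] with s hs
    have : ∫ _, erlangTail m (s * a) ∂ν = erlangTail m (s * a) := by simp
    refine le_of_le_of_eq (integral_mono_ae (integrable_erlangTail_mul_add hν hm hs ha.le)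
      (integrable_const _) ?_) this
    filter_upwards [hν] with y hy
    have h0 : 0 ≤ s * a := by positivity
    have h1 : s * a ≤ s * (y + a) := mul_le_mul_of_nonneg_left (by linarith) hs
    exact antitoneOn_erlangTail m h0 (h0.trans h1) h1

theorem tendsto_integral_one_sub_one_sub_exp_pow {ν : Measure ℝ} [IsProbabilityMeasure ν]
    (hν : ∀ᵐ y ∂ν, 0 ≤ y) (m : ℕ) {a : ℝ} (ha : 0 < a) :
    Tendsto (fun s => ∫ y, (1 - (1 - Real.exp (-(s * (y + a)))) ^ m) ∂ν) atTop (𝓝 0) := by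
  have hlim : Tendsto (fun s : ℝ => 1 - (1 - Real.exp (-(s * a))) ^ m) atTop (𝓝 0) := by
    have h1 : Tendsto (fun s : ℝ => Real.exp (-(s * a))) atTop (𝓝 0) :=
      Real.tendsto_exp_neg_atTop_nhds_zero.comp (tendsto_id.atTop_mul_const ha)
    simpa using ((h1.const_sub 1).pow m).const_sub 1
  refine squeeze_zero' ?_ ?_ hlim
  · filter_upwards [eventually_ge_atTop 0] with s hs
    refine integral_nonneg_of_ae ?_
    filter_upwards [hν] with y hy
    exact (one_sub_one_sub_exp_pow_mem_Icc m (by positivity)).1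
  · filter_upwards [eventually_ge_atTop 0] with s hs
    have : ∫ _, (1 - (1 - Real.exp (-(s * a))) ^ m) ∂ν = 1 - (1 - Real.exp (-(s * a))) ^ m := by
      simp
    refine le_of_le_of_eq (integral_mono_ae (integrable_one_sub_one_sub_exp_pow hν m hs ha.le)
      (integrable_const _) ?_) this
    filter_upwards [hν] with y hy
    have h0 : 0 ≤ s * a := by positivity
    have h1 : s * a ≤ s * (y + a) := mul_le_mul_of_nonneg_left (by linarith) hs
    have h2 : Real.exp (-(s * a)) ≤ 1 := Real.exp_le_one_iff.2 (by linarith)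
    have h3 : Real.exp (-(s * (y + a))) ≤ Real.exp (-(s * a)) := Real.exp_le_exp.2 (by linarith)
    have h4 := pow_le_pow_left₀ (sub_nonneg.2 h2) (sub_le_sub_left h3 1) m
    change 1 - (1 - Real.exp (-(s * (y + a)))) ^ m ≤ 1 - (1 - Real.exp (-(s * a))) ^ m
    linarith

/-! ### Decoding conditions as thresholds on the gain -/

namespace NetworkParams

theorem bL_pos {p : NetworkParams} (hm : 0 < p.mL) : 0 < p.bL := by
  unfold bL
  positivity

/-- The gamma tail of shape and rate `m_L` lies below the tail of the maximum of `m_L` independent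
exponential variables of rate `b_L`. -/
theorem erlangTail_le_of_rate_bL {p : NetworkParams} (hm : 0 < p.mL) {t : ℝ} (ht : 0 ≤ t) :
    erlangTail p.mL (p.mL * t) ≤ 1 - (1 - Real.exp (-(p.bL * t))) ^ p.mL := by
  unfold bL
  generalize p.mL = m at *
  obtain ⟨n, rfl⟩ := Nat.exists_eq_succ_of_ne_zero hm.ne'
  have hc : 0 < ((n + 1).factorial : ℝ) ^ (-(1 / ((n + 1 : ℕ) : ℝ))) := by positivity
  -- Since `b_L = m c` with `c = (m!)^{-1/m}`, Alzer's inequality is applied at `u = m t`.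
  have h := one_sub_exp_pow_le_one_sub_erlangTail n hc (by
    rw [← Real.rpow_mul_natCast (by positivity), neg_mul, one_div,
      inv_mul_cancel₀ (by positivity), Real.rpow_neg_one, inv_mul_cancel₀ (by positivity)])
    (u := (n + 1 : ℕ) * t) (by positivity)
  rw [mul_comm ((n + 1 : ℕ) : ℝ) (_ ^ _), mul_assoc]
  change erlangTail (n + 1) _ ≤ 1 - _ ^ (n + 1)
  linarith

/-- A signal-to-interference ratio exceeds a threshold exactly if a multiple of the signal power
exceeds a multiple of the interference. -/
theorem lt_div_iff_of_threshold {a b eps x W : ℝ} (hb : 0 ≤ b) (hx : 0 ≤ x) (hW : 0 < W) :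
    eps < a * x / (b * x + W) ↔ eps * W < (a - b * eps) * x := by
  rw [lt_div_iff₀ (by positivity)]
  constructor <;> intro h <;> linarith

theorem sinrFixed_gt_iff {p : NetworkParams} (hp : p.Admissible) {r g y eps : ℝ} (hr : 0 < r)
    (hg : 0 ≤ g) (hy : 0 ≤ y) : eps < p.sinrFixed r g y ↔
      eps * (y + p.noise) < (p.am - p.an * eps) * (p.PA * p.CL * r ^ (-p.alphaL) * g) := by
  have := hp.PA_pos
  have := hp.CL_pos
  have := hp.noise_pos
  rw [← lt_div_iff_of_threshold hp.an_pos.le (by positivity) (by positivity)]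
  unfold sinrFixed
  ring_nf

theorem sinrOwn_gt_iff {p : NetworkParams} (hp : p.Admissible) {r g y eps : ℝ} (hr : 0 < r)
    (hg : 0 ≤ g) (hy : 0 ≤ y) : eps < p.sinrOwn r g y ↔
      eps * (y + p.noise) <
        (p.an - p.beta * p.am * eps) * (p.PA * p.CL * r ^ (-p.alphaL) * g) := by
  have := hp.PA_pos
  have := hp.CL_pos
  have := hp.noise_pos
  have := hp.an_pos.trans hp.an_lt_am
  have := hp.beta_nonneg
  rw [← lt_div_iff_of_threshold (by positivity) (by positivity) (by positivity)]
  unfold sinrOwn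
  ring_nf

/-- Dividing each linear condition by its positive coefficient gives two lower bounds on the same
signal power, and the larger one is decisive. -/
theorem covered_iff {p : NetworkParams} (hp : p.Admissible) {r g y epsF epsT : ℝ} (hr : 0 < r)
    (hg : 0 ≤ g) (hy : 0 ≤ y) (hF : 0 < p.am - p.an * epsF)
    (hT : 0 < p.an - p.beta * p.am * epsT) :
    (epsF < p.sinrFixed r g y ∧ epsT < p.sinrOwn r g y) ↔
      p.epsStar epsF epsT * r ^ p.alphaL / (p.PA * p.CL) * (y + p.noise) < g := by
  have h1 := hp.PA_pos
  have h2 := hp.CL_pos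
  have h3 := hp.noise_pos
  have hr' : 0 < r ^ p.alphaL := by positivity
  have hx : ∀ e : ℝ, e * r ^ p.alphaL / (p.PA * p.CL) * (y + p.noise) < g ↔
      e * (y + p.noise) < p.PA * p.CL * r ^ (-p.alphaL) * g := by
    intro e
    rw [Real.rpow_neg hr.le, div_mul_eq_mul_div, div_lt_iff₀ (by positivity),
      mul_right_comm _ _ g, ← div_eq_mul_inv, lt_div_iff₀ hr', mul_right_comm, mul_comm g]
  rw [sinrFixed_gt_iff hp hr hg hy, sinrOwn_gt_iff hp hr hg hy, hx, epsStar,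
    max_mul_of_nonneg _ _ (by positivity), max_lt_iff, div_mul_eq_mul_div, div_lt_iff₀' hF,
    div_mul_eq_mul_div, div_lt_iff₀' hT]

theorem measurableSet_covered (p : NetworkParams) (r epsF epsT : ℝ) :
    MeasurableSet {q : ℝ × ℝ | epsF < p.sinrFixed r q.1 q.2 ∧ epsT < p.sinrOwn r q.1 q.2} := by
  have h1 : Measurable fun q : ℝ × ℝ => p.sinrFixed r q.1 q.2 := by unfold sinrFixed; fun_prop
  have h2 : Measurable fun q : ℝ × ℝ => p.sinrOwn r q.1 q.2 := by unfold sinrOwn; fun_prop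
  exact (measurableSet_lt measurable_const h1).inter (measurableSet_lt measurable_const h2)

theorem epsStar_pos {p : NetworkParams} {epsF epsT : ℝ} (hF : 0 < epsF)
    (h : 0 < p.am - p.an * epsF) : 0 < p.epsStar epsF epsT :=
  lt_max_of_lt_left (div_pos hF h)

end NetworkParams

/-! ### Coverage probability as an integral over the interference -/

namespace HetNet

variable {p : NetworkParams} {Ω : Type*} [MeasurableSpace Ω] {μ : Measure Ω}
  [IsProbabilityMeasure μ] (N : HetNet p μ)

instance (r : ℝ) : IsProbabilityMeasure (N.condLawInterf r) := by
  unfold condLawInterf; infer_instance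

theorem exactSum_eq_integral (hp : p.Admissible) {r e : ℝ} (hr : 0 < r) (he : 0 < e)
    (hν : ∀ᵐ y ∂(N.condLawInterf r), 0 ≤ y) :
    N.exactSum r e = ∫ y, erlangTail p.mL
      (p.mL * (e * r ^ p.alphaL / (p.PA * p.CL)) * (y + p.noise)) ∂(N.condLawInterf r) := by
  have h1 := hp.PA_pos
  have h2 := hp.CL_pos
  have h3 : (0 : ℝ) < p.mL := by exact_mod_cast hp.mL_pos
  rw [integral_erlangTail_mul_add hν _ (by positivity)]
  refine Finset.sum_congr rfl fun k _ => Finset.sum_congr rfl fun q _ => ?_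
  have hk : r ^ (p.alphaL * k) * (p.mL * e) ^ k / (k.factorial * (p.PA * p.CL) ^ k) =
      (p.mL * (e * r ^ p.alphaL / (p.PA * p.CL))) ^ k / k.factorial := by
    rw [Real.rpow_mul_natCast hr.le]
    simp only [mul_pow, div_pow]
    field_simp
  rw [hk, neg_mul (p.mL : ℝ)]
  rfl

theorem alternatingSum_eq_integral (hp : p.Admissible) {b r e : ℝ} (hb : 0 ≤ b) (hr : 0 < r)
    (he : 0 ≤ e) (hν : ∀ᵐ y ∂(N.condLawInterf r), 0 ≤ y) :
    N.alternatingSum b r e = ∫ y, (1 - (1 - Real.exp (-(b * (e * r ^ p.alphaL / (p.PA * p.CL)) *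
      (y + p.noise)))) ^ p.mL) ∂(N.condLawInterf r) := by
  have h1 := hp.PA_pos
  have h2 := hp.CL_pos
  rw [integral_one_sub_one_sub_exp_pow hν _ (by positivity)]
  refine Finset.sum_congr rfl fun k _ => ?_
  unfold laplaceInterf
  congr 2
  · congr 1
    ring
  · simp only [mul_assoc]

/-- By Fubini the gain is integrated out first; for each interference value it contributes a gamma
tail at the effective threshold. -/
theorem coverageNearLoS_eq_integral (hp : p.Admissible) {r epsF epsT : ℝ} (hr : 0 < r)
    (hF : 0 < epsF) (hF' : 0 < p.am - p.an * epsF) (hT' : 0 < p.an - p.beta * p.am * epsT)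
    (hprod : N.condLawGainInterf r = (gammaMeasure p.mL p.mL).prod (N.condLawInterf r))
    (hν : ∀ᵐ y ∂(N.condLawInterf r), 0 ≤ y) :
    N.coverageNearLoS epsF epsT r = ∫ y, erlangTail p.mL
      (p.mL * (p.epsStar epsF epsT * r ^ p.alphaL / (p.PA * p.CL)) * (y + p.noise))
        ∂(N.condLawInterf r) := by
  have h1 := hp.PA_pos
  have h2 := hp.CL_pos
  have h4 := hp.noise_pos
  have h3 : (0 : ℝ) < p.mL := by exact_mod_cast hp.mL_pos
  have he := p.epsStar_pos (epsT := epsT) hF hF'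
  have : IsProbabilityMeasure (gammaMeasure p.mL p.mL) := isProbabilityMeasure_gammaMeasure h3 h3
  rw [coverageNearLoS, hprod, Measure.real,
    Measure.prod_apply_symm (p.measurableSet_covered r epsF epsT),
    integral_eq_lintegral_of_nonneg_ae]
  · congr 1
    refine lintegral_congr_ae ?_
    filter_upwards [hν] with y hy
    have hset : gammaMeasure p.mL p.mL ((fun x => (x, y)) ⁻¹'
        {q : ℝ × ℝ | epsF < p.sinrFixed r q.1 q.2 ∧ epsT < p.sinrOwn r q.1 q.2}) =
        gammaMeasure p.mL p.mL (Set.Ioi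
          (p.epsStar epsF epsT * r ^ p.alphaL / (p.PA * p.CL) * (y + p.noise))) := by
      refine measure_congr ?_
      filter_upwards [gammaMeasure_ae_nonneg p.mL p.mL] with g hg
      exact propext (p.covered_iff hp hr hg hy hF' hT')
    rw [hset]
    obtain ⟨n, hn⟩ := Nat.exists_eq_succ_of_ne_zero hp.mL_pos.ne'
    have hG := gammaMeasure_Ioi n (ρ := p.mL) h3 (t := p.epsStar epsF epsT * r ^ p.alphaL /
      (p.PA * p.CL) * (y + p.noise)) (by positivity)
    rw [← Nat.succ_eq_add_one, ← hn] at hG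
    rw [hG, mul_assoc]
  · filter_upwards [hν] with y hy
    exact erlangTail_nonneg _ (by positivity)
  · exact ((continuous_erlangTail _).comp (by fun_prop)).aestronglyMeasurable

theorem coverageNearLoS_eq_zero (hp : p.Admissible) {r epsF epsT : ℝ} (hr : 0 < r)
    (hF : 0 < epsF) (hT : 0 < epsT)
    (h : p.am - p.an * epsF ≤ 0 ∨ p.an - p.beta * p.am * epsT ≤ 0)
    (hprod : N.condLawGainInterf r = (gammaMeasure p.mL p.mL).prod (N.condLawInterf r))
    (hν : ∀ᵐ y ∂(N.condLawInterf r), 0 ≤ y) :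
    N.coverageNearLoS epsF epsT r = 0 := by
  have h1 := hp.PA_pos
  have h2 := hp.CL_pos
  have h4 := hp.noise_pos
  have h3 : (0 : ℝ) < p.mL := by exact_mod_cast hp.mL_pos
  have : IsProbabilityMeasure (gammaMeasure p.mL p.mL) := isProbabilityMeasure_gammaMeasure h3 h3
  rw [coverageNearLoS, hprod, Measure.real,
    Measure.prod_apply_symm (p.measurableSet_covered r epsF epsT)]
  have : ∀ᵐ y ∂(N.condLawInterf r), gammaMeasure p.mL p.mL ((fun x => (x, y)) ⁻¹'
      {q : ℝ × ℝ | epsF < p.sinrFixed r q.1 q.2 ∧ epsT < p.sinrOwn r q.1 q.2}) = 0 := by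
    filter_upwards [hν] with y hy
    rw [← compl_compl ((fun x => (x, y)) ⁻¹' _), ← mem_ae_iff]
    filter_upwards [gammaMeasure_ae_nonneg p.mL p.mL] with g hg
    simp only [Set.mem_compl_iff, Set.mem_preimage, Set.mem_ofPred_eq]
    rw [p.sinrFixed_gt_iff hp hr hg hy, p.sinrOwn_gt_iff hp hr hg hy]
    have hx : 0 ≤ p.PA * p.CL * r ^ (-p.alphaL) * g := by positivity
    have hW : 0 < y + p.noise := by positivity
    rintro ⟨ha, hb⟩
    -- A nonpositive coefficient would place the positive quantity `eps * (y + noise)` strictly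
    -- below a nonpositive one.
    rcases h with h | h
    · nlinarith [mul_nonpos_of_nonpos_of_nonneg h hx, mul_pos hF hW]
    · nlinarith [mul_nonpos_of_nonpos_of_nonneg h hx, mul_pos hT hW]
  rw [lintegral_congr_ae this]
  simp

end HetNet

/-! ### Assembly of the three cases -/

theorem mainTheorem7 (p : NetworkParams) (hp : p.Admissible)
    {Ω : Type*} [MeasurableSpace Ω] (μ : Measure Ω) [IsProbabilityMeasure μ] (N : HetNet p μ)
    (epsF epsT : ℝ) (hF : 0 < epsF) (hT : 0 < epsT) :
    ∀ᵐ r ∂(N.lawLoS.map (N.distL 0)), r ≤ p.Rf →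
      -- both conditions hold, with nonzero denominators
      (0 < p.am - p.an * epsF → 0 < p.an - p.beta * p.am * epsT →
        -- the exact expression
        N.coverageNearLoS epsF epsT r = N.exactSum r (p.epsStar epsF epsT) ∧
        -- the approximation: `P(H < t)` is replaced by `(1 - exp (-b_L t)) ^ m_L`
        N.alternatingSum p.bL r (p.epsStar epsF epsT) =
          ∫ y, (1 - (1 - Real.exp (-p.bL *
            (p.epsStar epsF epsT * r ^ p.alphaL / (p.PA * p.CL) * (y + p.noise)))) ^ p.mL)
              ∂(N.condLawInterf r) ∧
        -- its accuracy: it is an upper bound, and rate `m_L` in place of `b_L` gives a lower bound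
        N.coverageNearLoS epsF epsT r ≤ N.alternatingSum p.bL r (p.epsStar epsF epsT) ∧
        N.alternatingSum p.mL r (p.epsStar epsF epsT) ≤ N.coverageNearLoS epsF epsT r) ∧
      -- the boundary case, in which the effective threshold is infinite
      (0 ≤ p.am - p.an * epsF → 0 ≤ p.an - p.beta * p.am * epsT →
        (p.am - p.an * epsF = 0 ∨ p.an - p.beta * p.am * epsT = 0) →
        N.coverageNearLoS epsF epsT r = 0 ∧
        Tendsto (fun e => N.exactSum r e) atTop (𝓝 0) ∧
        Tendsto (fun e => N.alternatingSum p.bL r e) atTop (𝓝 0)) ∧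
      -- one of the conditions fails
      ((p.am - p.an * epsF < 0 ∨ p.an - p.beta * p.am * epsT < 0) →
        N.coverageNearLoS epsF epsT r = 0) := by
  have hpos : ∀ᵐ r ∂(N.lawLoS.map (N.distL 0)), 0 < r :=
    (ae_map_iff (N.measurable_distL 0).aemeasurable measurableSet_Ioi).2
      (ae_of_all _ fun ω => N.distL_pos hp 0 ω)
  filter_upwards [hpos, N.condLawGainInterf_ae_eq hp, N.condLawInterf_ae_nonneg hp]
    with r hr hprod hν _
  have h1 := hp.PA_pos
  have h2 := hp.CL_pos
  have h3 : (0 : ℝ) < p.mL := by exact_mod_cast hp.mL_pos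
  have hnoise := hp.noise_pos
  have hb := p.bL_pos hp.mL_pos
  refine ⟨fun hF' hT' => ?_, fun _ _ h => ?_, fun h => ?_⟩
  · have he := p.epsStar_pos (epsT := epsT) hF hF'
    have hcov := N.coverageNearLoS_eq_integral hp hr hF hF' hT' hprod hν
    refine ⟨hcov.trans (N.exactSum_eq_integral hp hr he hν).symm, ?_, ?_, ?_⟩
    · rw [N.alternatingSum_eq_integral hp hb.le hr he.le hν]
      simp only [neg_mul, mul_assoc]
    · rw [hcov, N.alternatingSum_eq_integral hp hb.le hr he.le hν]
      refine integral_mono_ae (integrable_erlangTail_mul_add hν hp.mL_pos (by positivity)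
        hnoise.le) (integrable_one_sub_one_sub_exp_pow hν _ (by positivity) hnoise.le) ?_
      filter_upwards [hν] with y hy
      simp only [mul_assoc (p.mL : ℝ), mul_assoc p.bL]
      exact p.erlangTail_le_of_rate_bL hp.mL_pos (by positivity)
    · rw [hcov, N.alternatingSum_eq_integral hp h3.le hr he.le hν]
      refine integral_mono_ae (integrable_one_sub_one_sub_exp_pow hν _ (by positivity) hnoise.le)
        (integrable_erlangTail_mul_add hν hp.mL_pos (by positivity) hnoise.le) ?_
      filter_upwards [hν] with y hy
      have := one_sub_erlangTail_le p.mL (u := p.mL * (p.epsStar epsF epsT * r ^ p.alphaL /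
        (p.PA * p.CL)) * (y + p.noise)) (by positivity)
      linarith
  · refine ⟨N.coverageNearLoS_eq_zero hp hr hF hT (h.imp Eq.le Eq.le) hprod hν, ?_, ?_⟩
    all_goals
      -- The limit in `e` is the limit in the scale multiplying `y + noise`. The integral formulas
      -- are used for `e > 0` only, which suffices eventually.
      have hscale : ∀ {c : ℝ}, 0 < c →
          Tendsto (fun e : ℝ => c * (e * r ^ p.alphaL / (p.PA * p.CL))) atTop atTop := fun hc =>
        ((tendsto_id.atTop_mul_const (Real.rpow_pos_of_pos hr _)).atTop_div_const
          (by positivity)).const_mul_atTop hc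
    · refine ((tendsto_integral_erlangTail hν hp.mL_pos hnoise).comp (hscale h3)).congr' ?_
      filter_upwards [eventually_gt_atTop 0] with e he
      exact (N.exactSum_eq_integral hp hr he hν).symm
    · refine ((tendsto_integral_one_sub_one_sub_exp_pow hν p.mL hnoise).comp (hscale hb)).congr' ?_
      filter_upwards [eventually_gt_atTop 0] with e he
      exact (N.alternatingSum_eq_integral hp hb.le hr he.le hν).symm
  · exact N.coverageNearLoS_eq_zero hp hr hF hT (h.imp le_of_lt le_of_lt) hprod hν
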